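/- Let $M\subset\mathbb R^2$ be a closed embedded $C^2$ curve, that is, $M=\gamma(\mathbb R)$ for some $C^2$ map $\gamma:\mathbb R\to\mathbb R^2$ which is periodic with some period $L>0$, injective on $[0,L)$, and satisfies $\gamma'(t)\neq 0$ for all $t$. Assume Condition S: $M$ stays on one side of every vertical line tangent to $M$; that is, whenever $M$ has a vertical tangent at a point $(p_1,p_2)\in M$, either $x_1\le p_1$ for all $(x_1,x_2)\in M$, or $x_1\ge p_1$ for all $(x_1,x_2)\in M$. Let the curvature of $M$ at a point be its signed curvature with respect to the unit normal $\nu$ pointing into the region enclosed by $M$, i.e. $\langle\gamma''(t),\nu\rangle/|\gamma'(t)|^2$ at the point $\gamma(t)$ (so that it is positive for circles). Assume that whenever $(x_1,a)$ and $(x_1,b)$ with $a<b$ both lie on $M$, $$\text{curvature of } M \text{ at } (x_1,b)\ \le\ \text{curvature of } M \text{ at } (x_1,a).$$ Then there is $\lambda_0\in\mathbb R$ such that $M$ is symmetric about the line $x_2=\lambda_0$, i.e. $(x_1,x_2)\in M$ if and only if $(x_1,2\lambda_0-x_2)\in M$. -/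

import Mathlib

open Set Filter Topology

/-- The Euclidean plane; the coordinates of `p` are `p 0` (horizontal) and `p 1` (vertical). -/
abbrev Plane : Type := EuclideanSpace ℝ (Fin 2)

/-- `γ` is a regular `C²` parametrization, of period `L`, of the simple closed curve `M`. -/
structure IsC2Parametrization (M : Set Plane) (γ : ℝ → Plane) (L : ℝ) : Prop where
  period_pos : 0 < L
  contDiff : ContDiff ℝ 2 γ
  periodic : Function.Periodic γ L
  injOn : InjOn γ (Ico 0 L)
  deriv_ne_zero : ∀ t, deriv γ t ≠ 0
  range_eq : range γ = M

/-- `M` is a closed embedded `C²` curve in the plane. -/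
def IsClosedEmbeddedC2Curve (M : Set Plane) : Prop :=
  ∃ (γ : ℝ → Plane) (L : ℝ), IsC2Parametrization M γ L

/-- The vertical line through the point `p` of `M` is tangent to `M` at `p`. -/
def HasVerticalTangentAt (M : Set Plane) (p : Plane) : Prop :=
  ∃ (γ : ℝ → Plane) (L t : ℝ), IsC2Parametrization M γ L ∧ γ t = p ∧ deriv γ t 0 = 0

/-- Condition S: `M` stays on one side of every vertical line that is tangent to `M`. -/
def ConditionS (M : Set Plane) : Prop :=
  ∀ p, HasVerticalTangentAt M p → (∀ q ∈ M, q 0 ≤ p 0) ∨ (∀ q ∈ M, p 0 ≤ q 0)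

/-- The region enclosed by `M`: the points off `M` whose connected component in the
complement of `M` is bounded. -/
def enclosedRegion (M : Set Plane) : Set Plane :=
  {x | x ∉ M ∧ Bornology.IsBounded (connectedComponentIn Mᶜ x)}

/-- `κ` is the curvature of `M` at `p` with respect to the interior unit normal `ν`: in a
regular parametrization `γ` with `γ t = p` it is `⟪γ'' t, ν⟫ / |γ' t|²`
(positive on circles; the value does not depend on the parametrization). -/
def HasCurvatureAt (M : Set Plane) (p : Plane) (κ : ℝ) : Prop :=
  ∃ (γ : ℝ → Plane) (L t : ℝ) (ν : Plane),
    IsC2Parametrization M γ L ∧ γ t = p ∧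
    ‖ν‖ = 1 ∧ inner ℝ (deriv γ t) ν = 0 ∧
    (∀ᶠ ε : ℝ in 𝓝[>] 0, p + ε • ν ∈ enclosedRegion M) ∧
    κ = inner ℝ (deriv (deriv γ) t) ν / ‖deriv γ t‖ ^ 2

/-!
Condition S says that the abscissa of a parametrization `γ` of `M` is critical only where it takes
its minimum `m` or its maximum `N`. Consequently `M` consists of the graphs of two functions
`U₁, U₂` on `[m, N]`, one traversed to the right and one to the left, together with vertical
segments (possibly points) over `m` and `N` that join their ends
(`IsC2Parametrization.exists_isGraphPair`). No part of the Jordan curve theorem is needed: the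
complementary arcs avoid the graphs, so that they stay on one side of each of them. The set between
the graphs is bounded, and open and closed in the complement of `M`, so it lies in the enclosed
region (`mem_enclosedRegion_of_between`), which identifies the interior normal.

Let `s(u) = u / √(1 + u²)`. The curvature with respect to the upward normal of a graph `U` is
`(s(U'))'`, hence the curvature hypothesis says that `s(U₁') + s(U₂')` is nondecreasing on `(m, N)`.
At either end the tangent is vertical and its direction is the same at both ends of the vertical
segment; as the graphs are traversed in opposite directions, `s(U₁') + s(U₂')` tends to `0` there.
Therefore it vanishes identically, `U₁' = -U₂'`, and `U₁ + U₂` is a constant `c`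
(`IsGraphPair.exists_height_add_eq`): `M` is symmetric about `x₂ = c / 2`. In terms of `γ`,
`s(U₁')` is the sine of the tangent angle and `s(U₂')` is its negative, so the proof works with the
difference of two values of `sinAngle`.
-/

/-! ### Functions of one real variable -/

/-- Between a zero of `f - m` and a later zero of `f - N`, a function whose critical values are
among `m` and `N` has a strictly increasing arc from `m` to `N`: it ends at the first time `b` with
`f b = N` and starts at the last time before `b` at which `f = m`. -/
theorem exists_strictMonoOn_arc {f : ℝ → ℝ} (hf : Differentiable ℝ f) {m N p q : ℝ} (hpq : p ≤ q)
    (hmN : m < N)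
    (hcrit : ∀ t, deriv f t = 0 → f t = m ∨ f t = N) (hp : f p = m) (hq : f q = N) :
    ∃ a b, p ≤ a ∧ a < b ∧ b ≤ q ∧ f a = m ∧ f b = N ∧ StrictMonoOn f (Icc a b) ∧
      (∀ t ∈ Ioo a b, 0 < deriv f t) ∧ ∀ t ∈ Ico p b, f t ≠ N := by
  have hc := hf.continuous
  obtain ⟨b, ⟨⟨hpb, hbq⟩, hb⟩, hbmin⟩ := (isCompact_Icc.inter_right
    (isClosed_singleton.preimage hc : IsClosed (f ⁻¹' {N}))).exists_isLeast
      ⟨q, ⟨hpq, le_rfl⟩, hq⟩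
  obtain ⟨a, ⟨⟨hpa, hab⟩, ha⟩, hamax⟩ := (isCompact_Icc.inter_right
    (isClosed_singleton.preimage hc : IsClosed (f ⁻¹' {m}))).exists_isGreatest
      ⟨p, (⟨le_rfl, hpb⟩ : p ∈ Icc p b), hp⟩
  simp only [mem_preimage, mem_singleton_iff] at ha hb
  have hab' : a < b := lt_of_le_of_ne hab (by rintro rfl; linarith)
  have hNb : ∀ t ∈ Ico p b, f t ≠ N := fun t ht h =>
    absurd (hbmin ⟨⟨ht.1, ht.2.le.trans hbq⟩, h⟩) (not_le.2 ht.2)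
  have hne : ∀ t ∈ Ioo a b, deriv f t ≠ 0 := by
    intro t ht h
    rcases hcrit t h with h | h
    · exact absurd (hamax ⟨⟨hpa.trans ht.1.le, ht.2.le⟩, h⟩) (not_le.2 ht.1)
    · exact hNb t ⟨hpa.trans ht.1.le, ht.2⟩ h
  have hpos : ∀ t ∈ Ioo a b, 0 < deriv f t := by
    rcases hasDerivWithinAt_forall_lt_or_forall_gt_of_forall_ne (convex_Ioo a b)
      (fun t _ => (hf t).hasDerivAt.hasDerivWithinAt) hne with h | h
    · -- a negative derivative is incompatible with the end values `m < N`
      have := strictAntiOn_of_deriv_neg (convex_Icc a b) hc.continuousOn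
        (by rw [interior_Icc]; exact h) (left_mem_Icc.2 hab) (right_mem_Icc.2 hab) hab'
      linarith
    · exact h
  exact ⟨a, b, hpa, hab', hbq, ha, hb, strictMonoOn_of_deriv_pos (convex_Icc a b) hc.continuousOn
        (by rw [interior_Icc]; exact hpos), hpos, hNb⟩

/-- If `f` has minimum `m`, takes it at both ends of an interval and omits the only other possible
critical value inside, then `f` is constant there: an interior maximum is a critical point. -/
theorem eqOn_const_of_critical_values {f : ℝ → ℝ} (hf : Continuous f) {m N p q : ℝ}
    (hm : ∀ t, m ≤ f t) (hp : f p = m) (hq : f q = m)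
    (hcrit : ∀ t, deriv f t = 0 → f t = m ∨ f t = N) (hN : ∀ t ∈ Ioo p q, f t ≠ N) :
    ∀ t ∈ Icc p q, f t = m := by
  intro t ht
  obtain ⟨s, hs, hmax⟩ := isCompact_Icc.exists_isMaxOn ⟨t, ht⟩ hf.continuousOn
  have hle : f t ≤ f s := hmax ht
  suffices f s = m from le_antisymm (hle.trans this.le) (hm t)
  rcases eq_or_lt_of_le hs.1 with h | h1
  · rw [← h, hp]
  rcases eq_or_lt_of_le hs.2 with h | h2
  · rw [h, hq]
  exact (hcrit s (hmax.isLocalMax (Icc_mem_nhds h1 h2)).deriv_eq_zero).resolve_right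
    (hN s ⟨h1, h2⟩)

theorem StrictMonoOn.exists_continuous_inverse {f : ℝ → ℝ} (hf : Continuous f) {a b : ℝ}
    (hab : a ≤ b) (hmono : StrictMonoOn f (Icc a b)) :
    ∃ ξ : ℝ → ℝ, Continuous ξ ∧
      (∀ v ∈ Icc (f a) (f b), ξ v ∈ Icc a b ∧ f (ξ v) = v) ∧ ∀ t ∈ Icc a b, ξ (f t) = t := by
  have him : f '' Icc a b = Icc (f a) (f b) :=
    Subset.antisymm (by
      rintro _ ⟨t, ht, rfl⟩
      exact ⟨hmono.monotoneOn (left_mem_Icc.2 hab) ht ht.1,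
        hmono.monotoneOn ht (right_mem_Icc.2 hab) ht.2⟩)
      (intermediate_value_Icc hab hf.continuousOn)
  have hle : f a ≤ f b := hmono.monotoneOn (left_mem_Icc.2 hab) (right_mem_Icc.2 hab) hab
  let e : Icc a b ≃o Icc (f a) (f b) :=
    (hmono.orderIso f (Icc a b)).trans (OrderIso.setCongr _ _ him)
  have he : ∀ t, ((e t : Icc (f a) (f b)) : ℝ) = f t := fun t => rfl
  have hval : ∀ v (hv : v ∈ Icc (f a) (f b)),
      IccExtend hle (fun v => (e.symm v : ℝ)) v = e.symm ⟨v, hv⟩ :=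
    fun v hv => IccExtend_of_mem hle _ hv
  refine ⟨IccExtend hle (fun v => (e.symm v : ℝ)),
    (continuous_subtype_val.comp e.symm.continuous).Icc_extend', ?_, ?_⟩
  · intro v hv
    rw [hval v hv]
    exact ⟨(e.symm ⟨v, hv⟩).2, by rw [← he, e.apply_symm_apply]⟩
  · intro t ht
    have h : f t ∈ Icc (f a) (f b) := him ▸ mem_image_of_mem f ht
    rw [hval _ h]
    have : (⟨f t, h⟩ : Icc (f a) (f b)) = e ⟨t, ht⟩ := rfl
    rw [this, e.symm_apply_apply]

/-- A nonvanishing continuous function has constant sign on an interval. -/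
theorem mul_pos_of_forall_ne_zero {f : ℝ → ℝ} {s : Set ℝ} (hs : s.OrdConnected)
    (hf : ContinuousOn f s) (h0 : ∀ t ∈ s, f t ≠ 0) {t u : ℝ} (ht : t ∈ s) (hu : u ∈ s) :
    0 < f t * f u := by
  by_contra! h
  have hpre := hs.isPreconnected.image f hf
  have hmem : (0 : ℝ) ∈ f '' s := by
    rcases le_total (f t) 0 with h1 | h1 <;> rcases le_total (f u) 0 with h2 | h2
    · exact absurd (mul_pos_of_neg_of_neg (lt_of_le_of_ne h1 (h0 t ht))
        (lt_of_le_of_ne h2 (h0 u hu))) (not_lt.2 h)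
    · exact hpre.ordConnected.out (mem_image_of_mem f ht) (mem_image_of_mem f hu) ⟨h1, h2⟩
    · exact hpre.ordConnected.out (mem_image_of_mem f hu) (mem_image_of_mem f ht) ⟨h2, h1⟩
    · exact absurd (mul_pos (lt_of_le_of_ne h1 (h0 t ht).symm)
        (lt_of_le_of_ne h2 (h0 u hu).symm)) (not_lt.2 h)
  obtain ⟨s', hs', hz⟩ := hmem
  exact h0 s' hs' hz

/-! ### The Euclidean plane -/

theorem plane_sq_add_sq_pos {v : Plane} (hv : v ≠ 0) : 0 < v 0 ^ 2 + v 1 ^ 2 := by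
  rcases eq_or_ne (v 0) 0 with h0 | h0
  · rcases eq_or_ne (v 1) 0 with h1 | h1
    · exact absurd (PiLp.ext (Fin.forall_fin_two.2 ⟨h0, h1⟩)) hv
    · positivity
  · positivity

theorem plane_norm_eq (v : Plane) : ‖v‖ = √(v 0 ^ 2 + v 1 ^ 2) := by
  simp [EuclideanSpace.norm_eq, Fin.sum_univ_two]

theorem plane_norm_sq (v : Plane) : ‖v‖ ^ 2 = v 0 ^ 2 + v 1 ^ 2 := by
  rw [plane_norm_eq, Real.sq_sqrt (by positivity)]

theorem HasDerivAt.plane_apply {g : ℝ → Plane} {g' : Plane} {t : ℝ} (h : HasDerivAt g g' t)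
    (i : Fin 2) : HasDerivAt (fun s => g s i) (g' i) t :=
  ((EuclideanSpace.proj (𝕜 := ℝ) i).hasFDerivAt.comp_hasDerivAt t h)

/-- The sine of the angle of a moving vector `(X, Y)` has derivative the cosine times the angular
speed. -/
theorem hasDerivAt_div_sqrt {X Y : ℝ → ℝ} {X' Y' t : ℝ} (hX : HasDerivAt X X' t)
    (hY : HasDerivAt Y Y' t) (h : 0 < X t ^ 2 + Y t ^ 2) :
    HasDerivAt (fun s => Y s / √(X s ^ 2 + Y s ^ 2))
      (X t * ((X t * Y' - Y t * X') / √(X t ^ 2 + Y t ^ 2) ^ 3)) t := by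
  have hs : 0 < √(X t ^ 2 + Y t ^ 2) := Real.sqrt_pos.2 h
  have hsq : √(X t ^ 2 + Y t ^ 2) ^ 2 = X t ^ 2 + Y t ^ 2 := Real.sq_sqrt h.le
  have hq : HasDerivAt (fun s => X s ^ 2 + Y s ^ 2) (2 * X t * X' + 2 * Y t * Y') t := by
    simpa using (hX.fun_pow 2).fun_add (hY.fun_pow 2)
  refine (hY.fun_div (hq.sqrt h.ne') hs.ne').congr_deriv ?_
  set n := √(X t ^ 2 + Y t ^ 2)
  field_simp
  rw [hsq]
  ring

/-- Between two times over which `g'` does not vanish, `g` moves in one direction, from `g p` to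
`g q`. That `z` lies between `g p` and `g q`, in either order, is written as
`(z - g p) * (z - g q) ≤ 0`. -/
theorem segment_of_deriv_ne_zero {g : ℝ → ℝ} (hg : Differentiable ℝ g)
    (hg' : Continuous (deriv g)) {p q : ℝ} (hpq : p ≤ q) (h0 : ∀ t ∈ Icc p q, deriv g t ≠ 0) :
    0 < deriv g p * deriv g q ∧ (∀ t ∈ Icc p q, (g t - g p) * (g t - g q) ≤ 0) ∧
      ∀ z, (z - g p) * (z - g q) ≤ 0 → ∃ t ∈ Icc p q, g t = z := by
  have hp := left_mem_Icc.2 hpq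
  have hq := right_mem_Icc.2 hpq
  have hsign : ∀ t ∈ Icc p q, 0 < deriv g p * deriv g t := fun t ht =>
    mul_pos_of_forall_ne_zero ordConnected_Icc hg'.continuousOn h0 hp ht
  refine ⟨hsign q hq, fun t ht => ?_, fun z hz => ?_⟩
  · rcases lt_or_gt_of_ne (h0 p hp) with h | h
    · have hanti : AntitoneOn g (Icc p q) := (strictAntiOn_of_deriv_neg (convex_Icc p q)
        hg.continuous.continuousOn fun s hs =>
          neg_of_mul_pos_right (hsign s (interior_subset hs)) h.le).antitoneOn
      exact mul_nonpos_of_nonpos_of_nonneg (sub_nonpos.2 (hanti hp ht ht.1))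
        (sub_nonneg.2 (hanti ht hq ht.2))
    · have hmono : MonotoneOn g (Icc p q) := (strictMonoOn_of_deriv_pos (convex_Icc p q)
        hg.continuous.continuousOn fun s hs =>
          pos_of_mul_pos_right (hsign s (interior_subset hs)) h.le).monotoneOn
      exact mul_nonpos_of_nonneg_of_nonpos (sub_nonneg.2 (hmono hp ht ht.1))
        (sub_nonpos.2 (hmono ht hq ht.2))
  · have hz' : z ∈ uIcc (g p) (g q) := by
      rw [mem_uIcc]
      rcases mul_nonpos_iff.1 hz with h | h
      · left; constructor <;> linarith
      · right; constructor <;> linarith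
    obtain ⟨t, ht, rfl⟩ := intermediate_value_uIcc hg.continuous.continuousOn hz'
    exact ⟨t, uIcc_of_le hpq ▸ ht, rfl⟩

/-! ### Tangent direction of a parametrized curve -/

/-- The sine of the angle from the horizontal axis to the velocity of `γ`, that is, the vertical
component of the unit tangent vector. -/
noncomputable def sinAngle (γ : ℝ → Plane) (t : ℝ) : ℝ :=
  deriv γ t 1 / √(deriv γ t 0 ^ 2 + deriv γ t 1 ^ 2)

/-- Two vertical velocities that point the same way have the same direction. -/
theorem sinAngle_eq_of_vertical {γ : ℝ → Plane} {s t : ℝ} (hs : deriv γ s 0 = 0)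
    (ht : deriv γ t 0 = 0) (h : 0 < deriv γ s 1 * deriv γ t 1) : sinAngle γ s = sinAngle γ t := by
  simp only [sinAngle, hs, ht, ne_eq, OfNat.ofNat_ne_zero, not_false_eq_true, zero_pow, zero_add,
    Real.sqrt_sq_eq_abs]
  rcases pos_and_pos_or_neg_and_neg_of_mul_pos h with ⟨h1, h2⟩ | ⟨h1, h2⟩
  · rw [abs_of_pos h1, abs_of_pos h2, div_self h1.ne', div_self h2.ne']
  · rw [abs_of_neg h1, abs_of_neg h2, div_neg, div_neg, div_self h1.ne, div_self h2.ne]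

namespace IsC2Parametrization

variable {M : Set Plane} {γ : ℝ → Plane} {L : ℝ}

/-- The curve is injective on every window shorter than its period. -/
theorem eq_of_abs_sub_lt (h : IsC2Parametrization M γ L) {s t : ℝ} (hst : |s - t| < L)
    (he : γ s = γ t) : s = t := by
  have hL := h.period_pos
  have key : ∀ r, γ (toIcoMod hL 0 r) = γ r := fun r => by
    rw [toIcoMod]; exact h.periodic.sub_zsmul_eq _
  have hmem : ∀ r, toIcoMod hL 0 r ∈ Ico 0 L := fun r => by
    simpa using toIcoMod_mem_Ico hL 0 r
  have h1 : toIcoMod hL 0 s = toIcoMod hL 0 t :=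
    h.injOn (hmem s) (hmem t) (by rw [key, key, he])
  rw [toIcoMod, toIcoMod, zsmul_eq_mul, zsmul_eq_mul] at h1
  set k := toIcoDiv hL 0 s
  set l := toIcoDiv hL 0 t
  have h2 : s - t = ((k - l : ℤ) : ℝ) * L := by push_cast; linarith
  rw [h2, abs_mul, abs_of_pos hL] at hst
  have h3 : |((k - l : ℤ) : ℝ)| < 1 := by
    by_contra! hc
    nlinarith
  have h4 : k - l = 0 := by
    rw [← Int.cast_abs] at h3
    exact Int.abs_lt_one_iff.1 (by exact_mod_cast h3)
  rw [h4] at h2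
  simp only [Int.cast_zero, zero_mul] at h2
  linarith

theorem hasDerivAt (h : IsC2Parametrization M γ L) (t : ℝ) : HasDerivAt γ (deriv γ t) t :=
  ((h.contDiff.differentiable (by norm_num)) t).hasDerivAt

theorem contDiff_deriv (h : IsC2Parametrization M γ L) : ContDiff ℝ 1 (deriv γ) :=
  (contDiff_succ_iff_deriv.1 (by simpa [one_add_one_eq_two] using h.contDiff :
    ContDiff ℝ (1 + 1) γ)).2.2

theorem hasDerivAt_deriv (h : IsC2Parametrization M γ L) (t : ℝ) :
    HasDerivAt (deriv γ) (deriv (deriv γ) t) t :=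
  ((h.contDiff_deriv.differentiable (by norm_num)) t).hasDerivAt

theorem hasDerivAt_apply (h : IsC2Parametrization M γ L) (i : Fin 2) (t : ℝ) :
    HasDerivAt (fun s => γ s i) (deriv γ t i) t := (h.hasDerivAt t).plane_apply i

theorem deriv_apply (h : IsC2Parametrization M γ L) (i : Fin 2) :
    deriv (fun s => γ s i) = fun t => deriv γ t i :=
  funext fun t => (h.hasDerivAt_apply i t).deriv

theorem differentiable_apply (h : IsC2Parametrization M γ L) (i : Fin 2) :
    Differentiable ℝ (fun s => γ s i) := fun t => (h.hasDerivAt_apply i t).differentiableAt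

theorem continuous_deriv_apply (h : IsC2Parametrization M γ L) (i : Fin 2) :
    Continuous (fun t => deriv γ t i) :=
  (EuclideanSpace.proj (𝕜 := ℝ) i).continuous.comp h.contDiff_deriv.continuous

theorem deriv_one_ne_zero (h : IsC2Parametrization M γ L) {t : ℝ} (h0 : deriv γ t 0 = 0) :
    deriv γ t 1 ≠ 0 := fun h1 =>
  h.deriv_ne_zero t (PiLp.ext (Fin.forall_fin_two.2 ⟨h0, h1⟩))

theorem sq_add_sq_pos (h : IsC2Parametrization M γ L) (t : ℝ) :
    0 < deriv γ t 0 ^ 2 + deriv γ t 1 ^ 2 := plane_sq_add_sq_pos (h.deriv_ne_zero t)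

theorem continuous_sinAngle (h : IsC2Parametrization M γ L) : Continuous (sinAngle γ) :=
  (h.continuous_deriv_apply 1).div
    (((h.continuous_deriv_apply 0).pow 2).add ((h.continuous_deriv_apply 1).pow 2)).sqrt
    fun t => (Real.sqrt_pos.2 (h.sq_add_sq_pos t)).ne'

theorem deriv_add_period (h : IsC2Parametrization M γ L) (t : ℝ) :
    deriv γ (t + L) = deriv γ t := by
  rw [← deriv_comp_add_const]
  exact congrArg (fun g => deriv g t) (funext h.periodic)

end IsC2Parametrization

/-! ### Decomposition of the curve into two graphs -/

/-- The curve `M`, parametrized by `γ`, consists of two graphs over `[m, N]` and of the (possibly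
degenerate) vertical segments that join their end points. The graphs are those of
`v ↦ γ (ξᵢ v) 1`, where `ξ₁` inverts the abscissa on an arc that runs to the right and `ξ₂` on an arc
that runs to the left. It is left open which of the two graphs is the upper one; accordingly
"between the graphs" is expressed by the sign of a product. The fields `sinAngle_left` and
`sinAngle_right` record that the velocity has the same vertical direction at the two ends of each
segment. -/
structure IsGraphPair (M : Set Plane) (γ : ℝ → Plane) (m N : ℝ) (ξ₁ ξ₂ : ℝ → ℝ) : Prop where
  lt : m < N
  cont₁ : Continuous ξ₁
  cont₂ : Continuous ξ₂
  inv₁ : ∀ v ∈ Icc m N, γ (ξ₁ v) 0 = v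
  inv₂ : ∀ v ∈ Icc m N, γ (ξ₂ v) 0 = v
  pos₁ : ∀ v ∈ Ioo m N, 0 < deriv γ (ξ₁ v) 0
  neg₂ : ∀ v ∈ Ioo m N, deriv γ (ξ₂ v) 0 < 0
  height_ne : ∀ v ∈ Ioo m N, γ (ξ₁ v) 1 ≠ γ (ξ₂ v) 1
  sinAngle_left : sinAngle γ (ξ₁ m) = sinAngle γ (ξ₂ m)
  sinAngle_right : sinAngle γ (ξ₁ N) = sinAngle γ (ξ₂ N)
  mem_iff : ∀ q : Plane, q ∈ M ↔ q 0 ∈ Icc m N ∧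
    (q 1 = γ (ξ₁ (q 0)) 1 ∨ q 1 = γ (ξ₂ (q 0)) 1 ∨
      ((q 0 = m ∨ q 0 = N) ∧ (q 1 - γ (ξ₁ (q 0)) 1) * (q 1 - γ (ξ₂ (q 0)) 1) ≤ 0))

/-- Condition S confines the critical values of the abscissa `x` to its minimum `m` and its
maximum `N`. Hence there are an increasing arc `[a, b]` and a decreasing arc `[c, d]` with
`b ≤ c < d ≤ a + L`, chosen so that `x` omits `N` on `(c, a + L]`; then `x = m` on `[d, a + L]`.
On `(b, c)` the curve cannot cross the graphs of the arcs, so it stays between them and cannot reach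
the line `x = m`, on which the segment between the graphs is filled by `γ [d, a + L]`; so `x = N`
there. -/
theorem IsC2Parametrization.exists_isGraphPair {M : Set Plane} {γ : ℝ → Plane} {L : ℝ}
    (h : IsC2Parametrization M γ L) (hS : ConditionS M) :
    ∃ m N ξ₁ ξ₂, IsGraphPair M γ m N ξ₁ ξ₂ := by
  have hL := h.period_pos
  set x : ℝ → ℝ := fun t => γ t 0 with hx
  set y : ℝ → ℝ := fun t => γ t 1 with hy
  have hxd : Differentiable ℝ x := h.differentiable_apply 0
  have hyd : Differentiable ℝ y := h.differentiable_apply 1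
  have hx' : deriv x = fun t => deriv γ t 0 := h.deriv_apply 0
  have hy' : deriv y = fun t => deriv γ t 1 := h.deriv_apply 1
  have hyc' : Continuous (deriv y) := hy' ▸ h.continuous_deriv_apply 1
  have hxper : Function.Periodic x L := fun t => by simp only [hx, h.periodic t]
  have hyper : Function.Periodic y L := fun t => by simp only [hy, h.periodic t]
  have hext : ∀ s t, x s = x t → y s = y t → γ s = γ t := fun s t h0 h1 =>
    PiLp.ext (Fin.forall_fin_two.2 ⟨h0, h1⟩)
  have hMmem : ∀ t, γ t ∈ M := fun t => h.range_eq ▸ mem_range_self t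
  -- extremal abscissae
  have hcpt : IsCompact (range x) := hxper.compact_of_continuous hL.ne' hxd.continuous
  obtain ⟨_, ⟨p, rfl⟩, hp⟩ := hcpt.exists_isLeast (range_nonempty x)
  obtain ⟨_, ⟨q₀, rfl⟩, hq₀⟩ := hcpt.exists_isGreatest (range_nonempty x)
  obtain ⟨q, ⟨hpq, hqL⟩, hq⟩ := hxper.exists_mem_Ico hL q₀ p
  obtain ⟨m, hm⟩ : ∃ m, x p = m := ⟨_, rfl⟩
  obtain ⟨N, hN⟩ : ∃ N, x q = N := ⟨_, rfl⟩
  have hmx : ∀ t, m ≤ x t := fun t => hm ▸ hp (mem_range_self t)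
  have hxN : ∀ t, x t ≤ N := fun t => hN ▸ hq ▸ hq₀ (mem_range_self t)
  have hcrit : ∀ t, deriv x t = 0 → x t = m ∨ x t = N := by
    intro t ht
    rcases hS (γ t) ⟨γ, L, t, h, rfl, by rwa [hx'] at ht⟩ with h1 | h1
    · exact Or.inr (le_antisymm (hxN t) (hN ▸ h1 _ (hMmem q)))
    · exact Or.inl (le_antisymm (hm ▸ h1 _ (hMmem p)) (hmx t))
  have hvert_m : ∀ t, x t = m → deriv x t = 0 := fun t ht =>
    IsLocalMin.deriv_eq_zero (Eventually.of_forall fun s => ht ▸ hmx s)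
  have hvert_N : ∀ t, x t = N → deriv x t = 0 := fun t ht =>
    IsLocalMax.deriv_eq_zero (Eventually.of_forall fun s => ht ▸ hxN s)
  have hyne : ∀ t, deriv x t = 0 → deriv y t ≠ 0 := by
    intro t ht
    rw [hx'] at ht
    rw [hy']
    exact h.deriv_one_ne_zero ht
  have hmN : m < N := by
    refine lt_of_le_of_ne (hm ▸ hxN p) fun heq => ?_
    -- otherwise the periodic function `y` would have no critical point
    obtain ⟨c, -, hc⟩ := exists_deriv_eq_zero (f := y) hL hyd.continuous.continuousOn
      (by simpa using (hyper 0).symm)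
    exact hyne c (hvert_m c (le_antisymm (heq ▸ hxN c) (hmx c))) hc
  -- the increasing arc `[a, b]` and, by time reversal, the decreasing arc `[c, d]`
  obtain ⟨a, b, -, hab, -, ha, hb, hmono₁, hpos₁, -⟩ :=
    exists_strictMonoOn_arc hxd hpq hmN hcrit hm hN
  have hbaL : b ≤ a + L := by
    by_contra! hlt
    have := hmono₁ (left_mem_Icc.2 hab.le) ⟨by linarith, hlt.le⟩ (by linarith : a < a + L)
    rw [hxper a] at this
    exact lt_irrefl _ this
  have hneg' : ∀ t, deriv (fun s => x (-s)) t = -deriv x (-t) := fun t => deriv_comp_neg x t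
  obtain ⟨d', c', hd', hdc', hc', hd, hc, hmono₂, hpos₂, hne₂⟩ :=
    exists_strictMonoOn_arc (f := fun s => x (-s)) (p := -(a + L)) (q := -b)
      (hxd.comp differentiable_neg) (by linarith) hmN
      (fun t ht => hcrit (-t) (by rw [hneg'] at ht; linarith))
      (by simp only [neg_neg]; rw [hxper a, ha]) (by simp only [neg_neg]; exact hb)
  obtain ⟨c, rfl⟩ : ∃ c, c' = -c := ⟨-c', by simp⟩
  obtain ⟨d, rfl⟩ : ∃ d, d' = -d := ⟨-d', by simp⟩
  simp only [neg_neg] at hd hc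
  have hbc : b ≤ c := by linarith
  have hcd : c < d := by linarith
  have hdL : d ≤ a + L := by linarith
  have hne₂' : ∀ t ∈ Ioc c (a + L), x t ≠ N := fun t ht h1 =>
    hne₂ (-t) ⟨by linarith [ht.2], by linarith [ht.1]⟩ (by simpa using h1)
  -- inverses of the abscissa on the arcs
  obtain ⟨ξ₁, hξ₁c, hξ₁, hξ₁'⟩ := hmono₁.exists_continuous_inverse hxd.continuous hab.le
  obtain ⟨η, hηc, hη, hη'⟩ :=
    StrictMonoOn.exists_continuous_inverse (f := fun s => x (-s))
    (hxd.continuous.comp continuous_neg) hdc'.le hmono₂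
  rw [ha, hb] at hξ₁
  simp only [neg_neg, hc, hd] at hη
  obtain ⟨ξ₂, hξ₂def⟩ : ∃ ξ₂ : ℝ → ℝ, ξ₂ = fun v => -η v := ⟨_, rfl⟩
  have hξ₂c : Continuous ξ₂ := hξ₂def ▸ hηc.neg
  have hξ₂ : ∀ v ∈ Icc m N, ξ₂ v ∈ Icc c d ∧ x (ξ₂ v) = v := by
    intro v hv
    obtain ⟨⟨h1, h2⟩, h3⟩ := hη v hv
    subst hξ₂def
    exact ⟨⟨by linarith, by linarith⟩, h3⟩
  have hξ₂' : ∀ t ∈ Icc c d, ξ₂ (x t) = t := by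
    intro t ht
    have := hη' (-t) ⟨by linarith [ht.2], by linarith [ht.1]⟩
    simp only [neg_neg] at this
    subst hξ₂def
    simp [this]
  clear hξ₂def hηc hη hη'
  have e1m : ξ₁ m = a := ha ▸ hξ₁' a (left_mem_Icc.2 hab.le)
  have e1N : ξ₁ N = b := hb ▸ hξ₁' b (right_mem_Icc.2 hab.le)
  have e2m : ξ₂ m = d := hd ▸ hξ₂' d (right_mem_Icc.2 hcd.le)
  have e2N : ξ₂ N = c := hc ▸ hξ₂' c (left_mem_Icc.2 hcd.le)
  have hmI : m ∈ Icc m N := left_mem_Icc.2 hmN.le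
  have hNI : N ∈ Icc m N := right_mem_Icc.2 hmN.le
  have hξ₁o : ∀ v ∈ Ioo m N, ξ₁ v ∈ Ioo a b := by
    intro v hv
    obtain ⟨⟨h1, h2⟩, h3⟩ := hξ₁ v (Ioo_subset_Icc_self hv)
    refine ⟨lt_of_le_of_ne h1 ?_, lt_of_le_of_ne h2 ?_⟩ <;> intro he
    · rw [← he, ha] at h3; exact hv.1.ne h3
    · rw [he, hb] at h3; exact hv.2.ne' h3
  have hξ₂o : ∀ v ∈ Ioo m N, ξ₂ v ∈ Ioo c d := by
    intro v hv
    obtain ⟨⟨h1, h2⟩, h3⟩ := hξ₂ v (Ioo_subset_Icc_self hv)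
    refine ⟨lt_of_le_of_ne h1 ?_, lt_of_le_of_ne h2 ?_⟩ <;> intro he
    · rw [← he, hc] at h3; exact hv.2.ne' h3
    · rw [he, hd] at h3; exact hv.1.ne h3
  -- the rest of the curve avoids the graphs of the arcs
  have hF₁ : ∀ t ∈ Ioo b (a + L), y t - y (ξ₁ (x t)) ≠ 0 := by
    intro t ht h0
    obtain ⟨⟨h1, h2⟩, h3⟩ := hξ₁ (x t) ⟨hmx t, hxN t⟩
    have := h.eq_of_abs_sub_lt (s := t) (t := ξ₁ (x t))
      (by rw [abs_lt]; constructor <;> linarith [ht.1, ht.2])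
      (hext _ _ h3.symm (sub_eq_zero.1 h0))
    linarith [ht.1]
  have hF₂ : ∀ t ∈ Ioo a c, y t - y (ξ₂ (x t)) ≠ 0 := by
    intro t ht h0
    obtain ⟨⟨h1, h2⟩, h3⟩ := hξ₂ (x t) ⟨hmx t, hxN t⟩
    have := h.eq_of_abs_sub_lt (s := t) (t := ξ₂ (x t))
      (by rw [abs_lt]; constructor <;> linarith [ht.1, ht.2])
      (hext _ _ h3.symm (sub_eq_zero.1 h0))
    linarith [ht.2]
  have hyc := hyd.continuous
  have hF₁c : Continuous fun t => y t - y (ξ₁ (x t)) :=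
    hyc.sub (hyc.comp (hξ₁c.comp hxd.continuous))
  have hF₂c : Continuous fun t => y t - y (ξ₂ (x t)) :=
    hyc.sub (hyc.comp (hξ₂c.comp hxd.continuous))
  -- `x = m` on `[d, a + L]`
  have hleft : ∀ t ∈ Icc d (a + L), x t = m :=
    eqOn_const_of_critical_values hxd.continuous hmx hd (by rw [hxper, ha]) hcrit
      fun t ht => hne₂' t ⟨by linarith [ht.1], ht.2.le⟩
  obtain ⟨hsgn_l, hbet_l, hsurj_l⟩ := segment_of_deriv_ne_zero hyd hyc' hdL
    fun t ht => hyne t (hvert_m t (hleft t ht))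
  -- `x ≠ m` on `(b, c)`
  have hxm : ∀ t ∈ Ioo b c, x t ≠ m := by
    intro t ht hxt
    obtain ⟨v, hv⟩ : (Ioo m N).Nonempty := nonempty_Ioo.2 hmN
    have i1 := hξ₁o v hv
    have i2 := hξ₂o v hv
    have s1 := mul_pos_of_forall_ne_zero ordConnected_Ioo hF₁c.continuousOn hF₁
      (t := t) (u := ξ₂ v) ⟨ht.1, by linarith [ht.2]⟩ ⟨by linarith [i2.1], by linarith [i2.2]⟩
    have s2 := mul_pos_of_forall_ne_zero ordConnected_Ioo hF₂c.continuousOn hF₂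
      (t := t) (u := ξ₁ v) ⟨by linarith [ht.1], ht.2⟩ ⟨i1.1, by linarith [i1.2]⟩
    rw [(hξ₂ v (Ioo_subset_Icc_self hv)).2, hxt, e1m] at s1
    rw [(hξ₁ v (Ioo_subset_Icc_self hv)).2, hxt, e2m] at s2
    -- `y t` is strictly between the heights of the two graphs over `m`
    have hbetween : (y t - y d) * (y t - y (a + L)) ≤ 0 := by
      rw [hyper a]
      set D := y (ξ₂ v) - y (ξ₁ v)
      have hD : y (ξ₁ v) - y (ξ₂ v) = -D := by ring
      rw [hD] at s2
      have hDne : D ≠ 0 := by rintro h0; rw [h0] at s1; simp at s1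
      have := mul_pos s1 s2
      have hD2 : 0 < D ^ 2 := by positivity
      by_contra! hcon
      nlinarith [mul_pos hcon hD2]
    obtain ⟨s, hs, hys⟩ := hsurj_l (y t) hbetween
    have := h.eq_of_abs_sub_lt (s := s) (t := t)
      (by rw [abs_lt]; constructor <;> linarith [hs.1, hs.2, ht.1, ht.2])
      (hext _ _ (by rw [hleft s hs, hxt]) hys)
    linarith [hs.1, ht.2]
  have hright : ∀ t ∈ Icc b c, x t = N := by
    intro t ht
    have := eqOn_const_of_critical_values (f := fun s => -x s) (m := -N) (N := -m) (p := b) (q := c)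
      hxd.continuous.neg (fun s => neg_le_neg (hxN s)) (by rw [hb]) (by rw [hc])
      (fun s hs => by
        rw [deriv.fun_neg, neg_eq_zero] at hs
        rcases hcrit s hs with h1 | h1
        · right; rw [h1]
        · left; rw [h1])
      (fun s hs h1 => hxm s hs (neg_injective h1)) t ht
    exact neg_injective this
  obtain ⟨hsgn_r, hbet_r, hsurj_r⟩ := segment_of_deriv_ne_zero hyd hyc' hbc
    fun t ht => hyne t (hvert_N t (hright t ht))
  simp only [hx'] at hvert_m hvert_N
  simp only [hy'] at hsgn_l hsgn_r
  refine ⟨m, N, ξ₁, ξ₂, hmN, hξ₁c, hξ₂c, fun v hv => (hξ₁ v hv).2, fun v hv => (hξ₂ v hv).2,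
    fun v hv => ?_, fun v hv => ?_, fun v hv he => ?_, ?_, ?_, fun q => ⟨fun hq => ?_, ?_⟩⟩
  · have := hpos₁ _ (hξ₁o v hv)
    rwa [hx'] at this
  · have i2 := hξ₂o v hv
    have := hpos₂ (-ξ₂ v) ⟨by linarith [i2.2], by linarith [i2.1]⟩
    rw [hneg', neg_neg, hx'] at this
    linarith
  · have i2 := hξ₂o v hv
    refine hF₁ (ξ₂ v) ⟨by linarith [i2.1], by linarith [i2.2]⟩ ?_
    rw [(hξ₂ v (Ioo_subset_Icc_self hv)).2]
    exact sub_eq_zero.2 he.symm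
  · rw [e1m, e2m]
    refine sinAngle_eq_of_vertical (hvert_m a ha) (hvert_m d hd) ?_
    rw [h.deriv_add_period] at hsgn_l
    linarith
  · rw [e1N, e2N]
    exact sinAngle_eq_of_vertical (hvert_N b hb) (hvert_N c hc) hsgn_r
  · rw [← h.range_eq] at hq
    obtain ⟨t₀, rfl⟩ := hq
    obtain ⟨t, ht, ht'⟩ := h.periodic.exists_mem_Ico hL t₀ a
    rw [ht']
    refine ⟨⟨hmx t, hxN t⟩, ?_⟩
    change y t = y (ξ₁ (x t)) ∨ y t = y (ξ₂ (x t)) ∨ ((x t = m ∨ x t = N) ∧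
      (y t - y (ξ₁ (x t))) * (y t - y (ξ₂ (x t))) ≤ 0)
    rcases le_total t b with h1 | h1
    · left; rw [hξ₁' t ⟨ht.1, h1⟩]
    rcases le_total t c with h2 | h2
    · right; right
      rw [hright t ⟨h1, h2⟩, e1N, e2N]
      exact ⟨Or.inr rfl, hbet_r t ⟨h1, h2⟩⟩
    rcases le_total t d with h3 | h3
    · right; left; rw [hξ₂' t ⟨h2, h3⟩]
    · right; right
      rw [hleft t ⟨h3, ht.2.le⟩, e1m, e2m]
      have := hbet_l t ⟨h3, ht.2.le⟩
      rw [hyper a] at this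
      exact ⟨Or.inl rfl, by linarith⟩
  · have hmem : ∀ t, x t = q 0 → y t = q 1 → q ∈ M := fun t h0 h1 => by
      have : γ t = q := PiLp.ext (Fin.forall_fin_two.2 ⟨h0, h1⟩)
      exact this ▸ hMmem t
    rintro ⟨hq0, h1 | h1 | ⟨h1 | h1, h2⟩⟩
    · exact hmem _ (hξ₁ _ hq0).2 h1.symm
    · exact hmem _ (hξ₂ _ hq0).2 h1.symm
    · rw [h1, e1m, e2m] at h2
      obtain ⟨t, ht, hyt⟩ := hsurj_l (q 1) (by rw [hyper a]; simp only [hy]; linarith)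
      exact hmem t (by rw [hleft t ht, h1]) hyt
    · rw [h1, e1N, e2N] at h2
      obtain ⟨t, ht, hyt⟩ := hsurj_r (q 1) h2
      exact hmem t (by rw [hright t ht, h1]) hyt

/-! ### The enclosed region and the curvature -/

/-- The open set between the two graphs is closed in the complement of `M`, so it contains the
component of each of its points. -/
theorem mem_enclosedRegion_of_between {M : Set Plane} {U V : ℝ → ℝ} (hU : Continuous U)
    (hV : Continuous V) {m N : ℝ}
    (hM : ∀ q : Plane, q ∈ M ↔ q 0 ∈ Icc m N ∧ (q 1 = U (q 0) ∨ q 1 = V (q 0) ∨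
      ((q 0 = m ∨ q 0 = N) ∧ (q 1 - U (q 0)) * (q 1 - V (q 0)) ≤ 0)))
    {p : Plane} (hp0 : p 0 ∈ Ioo m N) (hp1 : (p 1 - U (p 0)) * (p 1 - V (p 0)) < 0) :
    p ∈ enclosedRegion M := by
  have c0 : Continuous fun q : Plane => q 0 := (EuclideanSpace.proj (𝕜 := ℝ) (0 : Fin 2)).continuous
  have c1 : Continuous fun q : Plane => q 1 := (EuclideanSpace.proj (𝕜 := ℝ) (1 : Fin 2)).continuous
  have cF : Continuous fun q : Plane => (q 1 - U (q 0)) * (q 1 - V (q 0)) :=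
    (c1.sub (hU.comp c0)).mul (c1.sub (hV.comp c0))
  set D : Set Plane := {q | q 0 ∈ Ioo m N ∧ (q 1 - U (q 0)) * (q 1 - V (q 0)) < 0} with hD
  set E : Set Plane := {q | q 0 ∈ Icc m N ∧ (q 1 - U (q 0)) * (q 1 - V (q 0)) ≤ 0} with hE
  have hDo : IsOpen D := (isOpen_Ioo.preimage c0).inter (isOpen_Iio.preimage cF)
  have hEc : IsClosed E := (isClosed_Icc.preimage c0).inter (isClosed_Iic.preimage cF)
  have hDM : D ⊆ Mᶜ := by
    rintro q ⟨h0, h1⟩ hq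
    rcases ((hM q).1 hq).2 with h | h | ⟨h | h, -⟩
    · simp [h] at h1
    · simp [h] at h1
    · exact h0.1.ne' h
    · exact h0.2.ne h
  have hcover : Mᶜ ⊆ D ∪ Eᶜ := by
    intro q hq
    by_cases hqE : q ∈ E
    · refine Or.inl ⟨⟨lt_of_le_of_ne hqE.1.1 ?_, lt_of_le_of_ne hqE.1.2 ?_⟩,
        lt_of_le_of_ne hqE.2 ?_⟩ <;> intro h
      · exact hq ((hM q).2 ⟨hqE.1, Or.inr (Or.inr ⟨Or.inl h.symm, hqE.2⟩)⟩)
      · exact hq ((hM q).2 ⟨hqE.1, Or.inr (Or.inr ⟨Or.inr h, hqE.2⟩)⟩)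
      · rcases mul_eq_zero.1 h with h | h
        · exact hq ((hM q).2 ⟨hqE.1, Or.inl (sub_eq_zero.1 h)⟩)
        · exact hq ((hM q).2 ⟨hqE.1, Or.inr (Or.inl (sub_eq_zero.1 h))⟩)
    · exact Or.inr hqE
  have hpD : p ∈ D := ⟨hp0, hp1⟩
  have hDE : D ⊆ E := fun q hq => ⟨Ioo_subset_Icc_self hq.1, hq.2.le⟩
  have hsub : connectedComponentIn Mᶜ p ⊆ D :=
    isPreconnected_connectedComponentIn.subset_left_of_subset_union hDo hEc.isOpen_compl
      (disjoint_compl_right.mono_left hDE)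
      ((connectedComponentIn_subset _ _).trans hcover)
      ⟨p, mem_connectedComponentIn (hDM hpD), hpD⟩
  refine ⟨hDM hpD, Bornology.IsBounded.subset ?_ hsub⟩
  obtain ⟨A, hA⟩ := isCompact_Icc.exists_bound_of_continuousOn (s := Icc m N) hU.continuousOn
  obtain ⟨B, hB⟩ := isCompact_Icc.exists_bound_of_continuousOn (s := Icc m N) hV.continuousOn
  refine (isBounded_iff_forall_norm_le.2 ⟨(|m| + |N|) + (A + B), fun q hq => ?_⟩)
  have hA' := abs_le.1 (hA (q 0) (hDE hq).1)
  have hB' := abs_le.1 (hB (q 0) (hDE hq).1)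
  have hA0 : 0 ≤ A := (norm_nonneg _).trans (hA (q 0) (hDE hq).1)
  have hB0 : 0 ≤ B := (norm_nonneg _).trans (hB (q 0) (hDE hq).1)
  have h0 : |q 0| ≤ |m| + |N| := by
    have := hq.1
    rw [abs_le]
    constructor <;> linarith [neg_abs_le m, le_abs_self N, this.1, this.2, abs_nonneg m,
      abs_nonneg N]
  have h1 : |q 1| ≤ A + B := by
    rw [abs_le]
    rcases mul_neg_iff.1 hq.2 with h | h
    · constructor <;> linarith [h.1, h.2, hA'.1, hA'.2, hB'.1, hB'.2]
    · constructor <;> linarith [h.1, h.2, hA'.1, hA'.2, hB'.1, hB'.2]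
  rw [plane_norm_eq]
  refine Real.sqrt_le_iff.2 ⟨by positivity, ?_⟩
  have h0' := sq_abs (q 0)
  have h1' := sq_abs (q 1)
  nlinarith [abs_nonneg (q 0), abs_nonneg (q 1), abs_nonneg m, abs_nonneg N]

/-- Starting from a point of the graph of `U`, a direction `ν` that crosses that graph towards the
graph of `V` enters the set between the graphs. -/
theorem eventually_between_of_transversal {U V : ℝ → ℝ} (hV : Continuous V) {m N U' : ℝ}
    {p ν : Plane} (hp0 : p 0 ∈ Ioo m N) (hp1 : p 1 = U (p 0)) (hU' : HasDerivAt U U' (p 0))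
    (hν : (ν 1 - U' * ν 0) * (U (p 0) - V (p 0)) < 0) :
    ∀ᶠ ε : ℝ in 𝓝[>] 0, (p + ε • ν) 0 ∈ Ioo m N ∧
      ((p + ε • ν) 1 - U ((p + ε • ν) 0)) * ((p + ε • ν) 1 - V ((p + ε • ν) 0)) < 0 := by
  have hco : ∀ (ε : ℝ) (i : Fin 2), (p + ε • ν) i = p i + ε * ν i := fun ε i => by simp
  simp only [hco]
  have hline : ∀ i : Fin 2, HasDerivAt (fun ε : ℝ => p i + ε * ν i) (ν i) 0 := fun i => by
    simpa using ((hasDerivAt_id (0 : ℝ)).mul_const (ν i)).const_add (p i)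
  have hU0 : HasDerivAt U U' ((fun ε : ℝ => p 0 + ε * ν 0) 0) := by simpa using hU'
  -- the sign of `y - U x` along the normal is that of its derivative at `0`
  have hF : HasDerivAt (fun ε : ℝ => ((p 1 + ε * ν 1) - U (p 0 + ε * ν 0)) *
      (U (p 0) - V (p 0))) ((ν 1 - U' * ν 0) * (U (p 0) - V (p 0))) 0 :=
    ((hline 1).sub (hU0.comp (0 : ℝ) (hline 0))).mul_const _
  have e1 : ∀ᶠ ε : ℝ in 𝓝[>] 0, ((p 1 + ε * ν 1) - U (p 0 + ε * ν 0)) *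
      (U (p 0) - V (p 0)) < 0 := by
    have hs := hF.tendsto_slope_zero_right.eventually (gt_mem_nhds hν)
    filter_upwards [hs, self_mem_nhdsWithin] with ε h1 h2
    simp only [zero_add, smul_eq_mul, zero_mul, add_zero, hp1, sub_self, sub_zero] at h1
    rw [hp1]
    exact neg_of_mul_neg_right h1 (inv_nonneg.2 (le_of_lt h2))
  have hg : Continuous fun ε : ℝ => ((p 1 + ε * ν 1) - V (p 0 + ε * ν 0)) *
      (U (p 0) - V (p 0)) := by fun_prop
  have hne : U (p 0) - V (p 0) ≠ 0 := by rintro h0; simp [h0] at hν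
  have e2 : ∀ᶠ ε : ℝ in 𝓝[>] 0, 0 < ((p 1 + ε * ν 1) - V (p 0 + ε * ν 0)) *
      (U (p 0) - V (p 0)) := by
    refine (hg.tendsto 0).mono_left nhdsWithin_le_nhds |>.eventually (lt_mem_nhds ?_)
    simp only [zero_mul, add_zero, hp1]
    exact mul_self_pos.2 hne
  have e3 : ∀ᶠ ε : ℝ in 𝓝[>] 0, p 0 + ε * ν 0 ∈ Ioo m N := by
    refine ((hline 0).continuousAt.tendsto.mono_left nhdsWithin_le_nhds).eventually
      (isOpen_Ioo.mem_nhds ?_)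
    simpa using hp0
  filter_upwards [e1, e2, e3] with ε h1 h2 h3
  refine ⟨h3, ?_⟩
  by_contra! hcon
  have hW : 0 < (U (p 0) - V (p 0)) ^ 2 := by positivity
  nlinarith [mul_neg_of_neg_of_pos h1 h2, mul_nonneg hcon hW.le]

/-- The signed curvature of `γ` with respect to the unit normal on the left of its velocity. -/
noncomputable def curvatureLeft (γ : ℝ → Plane) (t : ℝ) : ℝ :=
  (deriv γ t 0 * deriv (deriv γ) t 1 - deriv γ t 1 * deriv (deriv γ) t 0) /
    √(deriv γ t 0 ^ 2 + deriv γ t 1 ^ 2) ^ 3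

theorem IsC2Parametrization.hasDerivAt_sinAngle {M : Set Plane} {γ : ℝ → Plane} {L : ℝ}
    (h : IsC2Parametrization M γ L) (t : ℝ) :
    HasDerivAt (sinAngle γ) (deriv γ t 0 * curvatureLeft γ t) t :=
  hasDerivAt_div_sqrt ((h.hasDerivAt_deriv t).plane_apply 0) ((h.hasDerivAt_deriv t).plane_apply 1)
    (h.sq_add_sq_pos t)

/-- At a point of the graph of `U` where the curve is not vertical, the sign `σ` says whether the
normal on the left (`σ = 1`) or on the right (`σ = -1`) points towards the graph of `V`, and the
curvature with respect to the interior normal is `σ * curvatureLeft γ t`. -/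
theorem IsC2Parametrization.hasCurvatureAt {M : Set Plane} {γ : ℝ → Plane} {L : ℝ}
    (h : IsC2Parametrization M γ L) {t σ : ℝ} (hσ : σ ^ 2 = 1) {U V : ℝ → ℝ} (hU : Continuous U)
    (hV : Continuous V) {m N : ℝ}
    (hM : ∀ q : Plane, q ∈ M ↔ q 0 ∈ Icc m N ∧ (q 1 = U (q 0) ∨ q 1 = V (q 0) ∨
      ((q 0 = m ∨ q 0 = N) ∧ (q 1 - U (q 0)) * (q 1 - V (q 0)) ≤ 0)))
    (ht0 : γ t 0 ∈ Ioo m N) (ht1 : γ t 1 = U (γ t 0)) (hx : deriv γ t 0 ≠ 0)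
    (hU' : HasDerivAt U (deriv γ t 1 / deriv γ t 0) (γ t 0))
    (hside : σ * deriv γ t 0 * (U (γ t 0) - V (γ t 0)) < 0) :
    HasCurvatureAt M (γ t) (σ * curvatureLeft γ t) := by
  have hpos := h.sq_add_sq_pos t
  have hn : ‖deriv γ t‖ = √(deriv γ t 0 ^ 2 + deriv γ t 1 ^ 2) := plane_norm_eq _
  have hsq := plane_norm_sq (deriv γ t)
  have hnpos : 0 < ‖deriv γ t‖ := norm_pos_iff.2 (h.deriv_ne_zero t)
  rw [curvatureLeft, ← hn]
  set n := ‖deriv γ t‖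
  set X := deriv γ t 0 with hX
  set Y := deriv γ t 1 with hY
  refine ⟨γ, L, t, !₂[-(σ * Y / n), σ * X / n], h, rfl, ?_, ?_, ?_, ?_⟩
  · rw [plane_norm_eq]
    have : (-(σ * Y / n)) ^ 2 + (σ * X / n) ^ 2 = 1 := by
      field_simp
      rw [hsq, hσ]; ring
    simpa using this
  · simp only [PiLp.inner_apply, Fin.sum_univ_two]
    simp [← hX, ← hY]
    ring
  · refine (eventually_between_of_transversal hV ht0 ht1 hU' ?_).mono fun ε hε =>
      mem_enclosedRegion_of_between hU hV hM hε.1 hε.2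
    have : σ * X / n - Y / X * -(σ * Y / n) = σ * X * (n / X ^ 2) := by
      field_simp
      rw [hsq]; ring
    simp only [Matrix.cons_val_zero, Matrix.cons_val_one]
    rw [this]
    have hpos' : 0 < n / X ^ 2 := by positivity
    nlinarith [mul_neg_of_neg_of_pos hside hpos']
  · simp only [PiLp.inner_apply, Fin.sum_univ_two]
    simp only [conj_trivial, RCLike.inner_apply, Matrix.cons_val_zero, Matrix.cons_val_one]
    change _ = _ / n ^ 2
    field_simp
    ring

/-! ### Comparison of the two graphs -/

/-- Two vectors whose directions have equal sines, one pointing to the right and one to the left,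
have opposite slopes. -/
theorem add_div_eq_zero_of_sin_eq {x₁ y₁ x₂ y₂ : ℝ} (h1 : 0 < x₁) (h2 : x₂ < 0)
    (h : y₁ / √(x₁ ^ 2 + y₁ ^ 2) = y₂ / √(x₂ ^ 2 + y₂ ^ 2)) : y₁ / x₁ + y₂ / x₂ = 0 := by
  have p1 : 0 < √(x₁ ^ 2 + y₁ ^ 2) := Real.sqrt_pos.2 (by positivity)
  have p2 : 0 < √(x₂ ^ 2 + y₂ ^ 2) := Real.sqrt_pos.2 (by have := h2.ne; positivity)
  have s1 : √(x₁ ^ 2 + y₁ ^ 2) ^ 2 = x₁ ^ 2 + y₁ ^ 2 := Real.sq_sqrt (by positivity)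
  have s2 : √(x₂ ^ 2 + y₂ ^ 2) ^ 2 = x₂ ^ 2 + y₂ ^ 2 := Real.sq_sqrt (by positivity)
  set n₁ := √(x₁ ^ 2 + y₁ ^ 2)
  set n₂ := √(x₂ ^ 2 + y₂ ^ 2)
  rw [div_eq_div_iff p1.ne' p2.ne'] at h
  have hx : x₁ * n₂ = -x₂ * n₁ := by
    have hsq : (x₁ * n₂) ^ 2 = (-x₂ * n₁) ^ 2 := by
      have : (y₁ * n₂) ^ 2 = (y₂ * n₁) ^ 2 := by rw [h]
      rw [mul_pow, mul_pow, s1, s2] at *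
      linarith
    exact (pow_left_inj₀ (by positivity) (mul_nonneg (by linarith) p1.le) two_ne_zero).1 hsq
  rw [div_add_div _ _ h1.ne' h2.ne, div_eq_zero_iff]
  left
  have : (y₁ * x₂ + x₁ * y₂) * (n₁ * n₂) = 0 := by linear_combination x₂ * n₁ * h + y₂ * n₁ * hx
  exact (mul_eq_zero.1 this).resolve_right (by positivity)

namespace IsGraphPair

variable {M : Set Plane} {γ : ℝ → Plane} {L m N : ℝ} {ξ₁ ξ₂ : ℝ → ℝ}

theorem hasDerivAt_inverse (h : IsC2Parametrization M γ L) {ξ : ℝ → ℝ} (hξ : Continuous ξ)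
    (hinv : ∀ v ∈ Icc m N, γ (ξ v) 0 = v) {v : ℝ} (hv : v ∈ Ioo m N)
    (h0 : deriv γ (ξ v) 0 ≠ 0) : HasDerivAt ξ (deriv γ (ξ v) 0)⁻¹ v :=
  HasDerivAt.of_local_left_inverse hξ.continuousAt (h.hasDerivAt_apply 0 (ξ v)) h0
    (by filter_upwards [Icc_mem_nhds hv.1 hv.2] with w hw using hinv w hw)

theorem hasDerivAt_height (h : IsC2Parametrization M γ L) {ξ : ℝ → ℝ} (hξ : Continuous ξ)
    (hinv : ∀ v ∈ Icc m N, γ (ξ v) 0 = v) {v : ℝ} (hv : v ∈ Ioo m N)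
    (h0 : deriv γ (ξ v) 0 ≠ 0) :
    HasDerivAt (fun v => γ (ξ v) 1) (deriv γ (ξ v) 1 / deriv γ (ξ v) 0) v :=
  (h.hasDerivAt_apply 1 (ξ v)).comp v (hasDerivAt_inverse h hξ hinv hv h0)

/-- With the abscissa as parameter, the sine of the tangent angle has the curvature as derivative. -/
theorem hasDerivAt_sinAngle (h : IsC2Parametrization M γ L) {ξ : ℝ → ℝ} (hξ : Continuous ξ)
    (hinv : ∀ v ∈ Icc m N, γ (ξ v) 0 = v) {v : ℝ} (hv : v ∈ Ioo m N)
    (h0 : deriv γ (ξ v) 0 ≠ 0) :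
    HasDerivAt (fun v => sinAngle γ (ξ v)) (curvatureLeft γ (ξ v)) v := by
  refine ((h.hasDerivAt_sinAngle (ξ v)).comp v
    (hasDerivAt_inverse h hξ hinv hv h0)).congr_deriv ?_
  field_simp

/-- The hypothesis on the curvature takes the same form whichever graph is the upper one: the two
arcs run in opposite directions, so the interior lies on the left of both or on the right of both,
and interchanging the graphs also changes the sign of both curvatures. -/
theorem curvatureLeft_le (hP : IsGraphPair M γ m N ξ₁ ξ₂) (h : IsC2Parametrization M γ L)
    (hcurv : ∀ x₁ a b κa κb : ℝ, a < b →
      HasCurvatureAt M !₂[x₁, a] κa → HasCurvatureAt M !₂[x₁, b] κb → κb ≤ κa)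
    {v : ℝ} (hv : v ∈ Ioo m N) : curvatureLeft γ (ξ₂ v) ≤ curvatureLeft γ (ξ₁ v) := by
  have hvI := Ioo_subset_Icc_self hv
  have hy : Continuous fun t => γ t 1 := (h.differentiable_apply 1).continuous
  have i1 := hP.inv₁ v hvI
  have i2 := hP.inv₂ v hvI
  have hp := hP.pos₁ v hv
  have hn := hP.neg₂ v hv
  have e1 : γ (ξ₁ v) = !₂[v, γ (ξ₁ v) 1] :=
    PiLp.ext (Fin.forall_fin_two.2 ⟨by simpa using i1, by simp⟩)
  have e2 : γ (ξ₂ v) = !₂[v, γ (ξ₂ v) 1] :=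
    PiLp.ext (Fin.forall_fin_two.2 ⟨by simpa using i2, by simp⟩)
  have k1 : ∀ σ : ℝ, σ ^ 2 = 1 → σ * deriv γ (ξ₁ v) 0 * (γ (ξ₁ v) 1 - γ (ξ₂ v) 1) < 0 →
      HasCurvatureAt M !₂[v, γ (ξ₁ v) 1] (σ * curvatureLeft γ (ξ₁ v)) := fun σ hσ hs => by
    rw [← e1]
    exact h.hasCurvatureAt hσ (hy.comp hP.cont₁) (hy.comp hP.cont₂) hP.mem_iff (i1.symm ▸ hv)
      (by simp only [Function.comp, i1]) hp.ne'
      (by rw [i1]; exact hasDerivAt_height h hP.cont₁ hP.inv₁ hv hp.ne')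
      (by simpa only [Function.comp, i1] using hs)
  have k2 : ∀ σ : ℝ, σ ^ 2 = 1 → σ * deriv γ (ξ₂ v) 0 * (γ (ξ₂ v) 1 - γ (ξ₁ v) 1) < 0 →
      HasCurvatureAt M !₂[v, γ (ξ₂ v) 1] (σ * curvatureLeft γ (ξ₂ v)) := fun σ hσ hs => by
    rw [← e2]
    refine h.hasCurvatureAt hσ (hy.comp hP.cont₂) (hy.comp hP.cont₁) (m := m) (N := N)
      (fun q => ?_) (i2.symm ▸ hv) (by simp only [Function.comp, i2]) hn.ne
      (by rw [i2]; exact hasDerivAt_height h hP.cont₂ hP.inv₂ hv hn.ne)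
      (by simpa only [Function.comp, i2] using hs)
    rw [hP.mem_iff q]
    simp only [Function.comp]
    rw [or_left_comm, mul_comm (q 1 - γ (ξ₂ (q 0)) 1)]
  rcases lt_or_gt_of_ne (hP.height_ne v hv) with hlt | hlt
  · have := hcurv v _ _ _ _ hlt (k1 1 (by norm_num) (by nlinarith))
      (k2 1 (by norm_num) (by nlinarith))
    linarith
  · have := hcurv v _ _ _ _ hlt (k2 (-1) (by norm_num) (by nlinarith))
      (k1 (-1) (by norm_num) (by nlinarith))
    linarith

/-- The difference of the sines is monotone in the abscissa and vanishes at both ends. -/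
theorem sinAngle_eq (hP : IsGraphPair M γ m N ξ₁ ξ₂) (h : IsC2Parametrization M γ L)
    (hcurv : ∀ v ∈ Ioo m N, curvatureLeft γ (ξ₂ v) ≤ curvatureLeft γ (ξ₁ v))
    {v : ℝ} (hv : v ∈ Icc m N) : sinAngle γ (ξ₁ v) = sinAngle γ (ξ₂ v) := by
  have hd : ∀ v ∈ Ioo m N, HasDerivAt (fun v => sinAngle γ (ξ₁ v) - sinAngle γ (ξ₂ v))
      (curvatureLeft γ (ξ₁ v) - curvatureLeft γ (ξ₂ v)) v := fun v hv =>
    (hasDerivAt_sinAngle h hP.cont₁ hP.inv₁ hv (hP.pos₁ v hv).ne').sub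
      (hasDerivAt_sinAngle h hP.cont₂ hP.inv₂ hv (hP.neg₂ v hv).ne)
  have hmono : MonotoneOn (fun v => sinAngle γ (ξ₁ v) - sinAngle γ (ξ₂ v)) (Icc m N) := by
    refine monotoneOn_of_deriv_nonneg (convex_Icc m N)
      ((h.continuous_sinAngle.comp hP.cont₁).sub
        (h.continuous_sinAngle.comp hP.cont₂)).continuousOn ?_ ?_ <;>
      rw [interior_Icc]
    · exact fun v hv => (hd v hv).differentiableAt.differentiableWithinAt
    · exact fun v hv => (hd v hv).deriv ▸ sub_nonneg.2 (hcurv v hv)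
  have h1 := hmono (left_mem_Icc.2 hP.lt.le) hv hv.1
  have h2 := hmono hv (right_mem_Icc.2 hP.lt.le) hv.2
  simp only [hP.sinAngle_left, hP.sinAngle_right, sub_self] at h1 h2
  linarith

theorem exists_height_add_eq (hP : IsGraphPair M γ m N ξ₁ ξ₂) (h : IsC2Parametrization M γ L)
    (hcurv : ∀ v ∈ Ioo m N, curvatureLeft γ (ξ₂ v) ≤ curvatureLeft γ (ξ₁ v)) :
    ∃ c, ∀ v ∈ Icc m N, γ (ξ₁ v) 1 + γ (ξ₂ v) 1 = c := by
  have hy : Continuous fun t => γ t 1 := (h.differentiable_apply 1).continuous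
  refine ⟨γ (ξ₁ m) 1 + γ (ξ₂ m) 1, fun v hv => ?_⟩
  rcases eq_or_lt_of_le hv.1 with rfl | hmv
  · rfl
  have hd : ∀ w ∈ Ioo m v, HasDerivAt (fun w => γ (ξ₁ w) 1 + γ (ξ₂ w) 1) 0 w := by
    intro w hw
    have hw' : w ∈ Ioo m N := ⟨hw.1, hw.2.trans_le hv.2⟩
    rw [← add_div_eq_zero_of_sin_eq (hP.pos₁ w hw') (hP.neg₂ w hw')
      (hP.sinAngle_eq h hcurv (Ioo_subset_Icc_self hw'))]
    exact (hasDerivAt_height h hP.cont₁ hP.inv₁ hw' (hP.pos₁ w hw').ne').add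
      (hasDerivAt_height h hP.cont₂ hP.inv₂ hw' (hP.neg₂ w hw').ne)
  obtain ⟨w, -, hw⟩ := exists_hasDerivAt_eq_slope _ (fun _ => 0) hmv
    ((hy.comp hP.cont₁).add (hy.comp hP.cont₂)).continuousOn hd
  rw [eq_comm, div_eq_zero_iff] at hw
  have := hw.resolve_right (sub_pos.2 hmv).ne'
  exact sub_eq_zero.1 this

theorem reflect_mem (hP : IsGraphPair M γ m N ξ₁ ξ₂) {c : ℝ}
    (hc : ∀ v ∈ Icc m N, γ (ξ₁ v) 1 + γ (ξ₂ v) 1 = c) {x₁ x₂ : ℝ} (hq : !₂[x₁, x₂] ∈ M) :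
    !₂[x₁, c - x₂] ∈ M := by
  rw [hP.mem_iff] at hq ⊢
  simp only [Matrix.cons_val_zero, Matrix.cons_val_one] at hq ⊢
  obtain ⟨h0, h1⟩ := hq
  have hsum := hc x₁ h0
  refine ⟨h0, ?_⟩
  rcases h1 with h1 | h1 | ⟨h1, h2⟩
  · exact Or.inr (Or.inl (by linarith))
  · exact Or.inl (by linarith)
  · refine Or.inr (Or.inr ⟨h1, ?_⟩)
    rw [← hsum]
    linarith

end IsGraphPair

theorem theorem1p4 (M : Set Plane) (hM : IsClosedEmbeddedC2Curve M) (hS : ConditionS M)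
    (hcurv : ∀ x₁ a b κa κb : ℝ, a < b →
      HasCurvatureAt M !₂[x₁, a] κa → HasCurvatureAt M !₂[x₁, b] κb → κb ≤ κa) :
    ∃ lam : ℝ, ∀ x₁ x₂ : ℝ, !₂[x₁, x₂] ∈ M ↔ !₂[x₁, 2 * lam - x₂] ∈ M := by
  obtain ⟨γ, L, h⟩ := hM
  obtain ⟨m, N, ξ₁, ξ₂, hP⟩ := h.exists_isGraphPair hS
  obtain ⟨c, hc⟩ := hP.exists_height_add_eq h fun v hv => hP.curvatureLeft_le h hcurv hv
  refine ⟨c / 2, fun x₁ x₂ => ?_⟩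
  rw [mul_div_cancel₀ c two_ne_zero]
  exact ⟨hP.reflect_mem hc, fun hq => by simpa using hP.reflect_mem hc hq⟩
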